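/- Let $\mathbb{K}$ be a field of characteristic $0$ and let $n\ge 0$ be an integer. A partition is a non-increasing sequence $\lambda=(\lambda_1,\lambda_2,\ldots)$ of non-negative integers with finite sum $|\lambda|=\sum_i\lambda_i$ (trailing zeros are ignored), and a bipartition of $n$ is a pair $(\lambda,\mu)$ of partitions with $|\lambda|+|\mu|=n$; $\mathcal{BP}_n$ is the set of bipartitions of $n$. For $(\vartheta,\omega),(\lambda,\mu)\in\mathcal{BP}_n$ write $(\vartheta,\omega)\unlhd(\lambda,\mu)$, and say that $(\lambda,\mu)$ bidominates $(\vartheta,\omega)$, if for all integers $k\ge 1$ $$\sum_{j=1}^{k}(\vartheta_j+\omega_j)\le\sum_{j=1}^{k}(\lambda_j+\mu_j)\quad\text{and}\quad \sum_{j=1}^{k-1}(\vartheta_j+\omega_j)+\vartheta_k\le\sum_{j=1}^{k-1}(\lambda_j+\mu_j)+\lambda_k .$$ A bitableau $(T,S)$ of shape $(\lambda,\mu)\in\mathcal{BP}_n$ is a filling of the boxes of the Young diagrams of $\lambda$ and $\mu$ with the numbers $1,\ldots,n$, each used exactly once. With $\Delta_{(i_1,\ldots,i_m)}(\mathbf{x})=\prod_{1\le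 j<k\le m}(\mathbf{x}_{i_j}-\mathbf{x}_{i_k})$ and $\mathbf{x}^2=(\mathbf{x}_1^2,\ldots,\mathbf{x}_n^2)$, its $B_n$-Specht polynomial is $$\mathrm{spe}_{(T,S)}(\mathbf{x})=\prod_{i}\Delta_{T_i}(\mathbf{x}^2)\,\prod_{j}\Delta_{S_j}(\mathbf{x}^2)\prod_{k\in S}\mathbf{x}_k ,$$ where $T_i$ and $S_j$ are the sequences of entries, from top to bottom, of the $i$-th column of $T$ and the $j$-th column of $S$. The $B_n$-Specht variety $V_{(\lambda,\mu)}\subset\mathbb{K}^n$ is the set of common zeros in $\mathbb{K}^n$ of the ideal of $\mathbb{K}[\mathbf{x}_1,\ldots,\mathbf{x}_n]$ generated by all $\mathrm{spe}_{(T,S)}$ with $(T,S)$ a bitableau of shape $(\lambda,\mu)$. The $\mathcal{S}_n$-orbit type $\Lambda(y)$ of $y\in\mathbb{K}^n$ is the partition $(\Lambda_1,\ldots,\Lambda_l)$ of $n$ such that $y$ is a permutation of $(b_1,\ldots,b_1,\ldots,b_l,\ldots,b_l)$ for some pairwise distinct $b_1,\ldots,b_l\in\mathbb{K}$, where $b_i$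 occurs $\Lambda_i$ times. For an integer $t\ge 0$, the $t$-cut of a partition $\lambda$ is the bipartition $\mathrm{cut}(\lambda,t)=(\rho,\sigma)$ with $\rho_i=\min(\lambda_i,t)$ and $\sigma_i=\max(\lambda_i-t,0)$ for all $i$. The $B_n$-orbit type of $z=(z_1,\ldots,z_n)\in\mathbb{K}^n$ is $\Omega(z)=\mathrm{cut}(\Lambda(z_1^2,\ldots,z_n^2),t_z)$, where $t_z$ is the number of zero coordinates of $z$, and for $(\vartheta,\omega)\in\mathcal{BP}_n$ the $B_n$-orbit set is $H_{(\vartheta,\omega)}=\{z\in\mathbb{K}^n:\Omega(z)=(\vartheta,\omega)\}$. **Theorem.** For every bipartition $(\lambda,\mu)\in\mathcal{BP}_n$, $$V_{(\lambda,\mu)}=\mathbb{K}^n\setminus\bigcup_{\substack{(\vartheta,\omega)\in\mathcal{BP}_n\\(\vartheta,\omega)\unlhd(\lambda,\mu)}}H_{(\vartheta,\omega)}=\bigcup_{\substack{(\vartheta,\omega)\in\mathcal{BP}_n\\(\vartheta,\omega)\not\unlhd(\lambda,\mu)}}H_{(\vartheta,\omega)} .$$ -/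

import Mathlib

namespace BnSpecht

/-- A bipartition of `n`: a pair of partitions whose sizes add up to `n`. A partition
`λ = (λ₁, λ₂, …)` is given by its Young diagram; with rows counted from `0`, its `(i + 1)`-st part
is `rowLen i`, which is `0` beyond the length of the partition. -/
@[ext]
structure Bipartition (n : ℕ) where
  fst : YoungDiagram
  snd : YoungDiagram
  card_add_card : fst.card + snd.card = n

/-- `BidominatedBy b' b`: the bipartition `b = (λ, μ)` bidominates `b' = (λ', μ')`, that is,
`∑_{j ≤ k} (λ'_j + μ'_j) ≤ ∑_{j ≤ k} (λ_j + μ_j)` and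
`∑_{j < k} (λ'_j + μ'_j) + λ'_k ≤ ∑_{j < k} (λ_j + μ_j) + λ_k` for all positive `k`
(below, `k + 1` stands for this `k`, and parts are counted from `0`). -/
def BidominatedBy {n : ℕ} (b' b : Bipartition n) : Prop :=
  ∀ k : ℕ,
    ∑ j ∈ Finset.range (k + 1), (b'.fst.rowLen j + b'.snd.rowLen j) ≤
        ∑ j ∈ Finset.range (k + 1), (b.fst.rowLen j + b.snd.rowLen j) ∧
      ∑ j ∈ Finset.range k, (b'.fst.rowLen j + b'.snd.rowLen j) + b'.fst.rowLen k ≤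
        ∑ j ∈ Finset.range k, (b.fst.rowLen j + b.snd.rowLen j) + b.fst.rowLen k

/-! ### Specht polynomials, ideals and varieties -/

/-- A filling of the boxes of the diagram `d` with entries in `α`. -/
abbrev Filling (d : YoungDiagram) (α : Type*) := {c : ℕ × ℕ // c ∈ d.cells} → α

/-- The sequence of the entries of the `j`-th column of a filling, from above to below. -/
def Filling.column {d : YoungDiagram} {α : Type*} (T : Filling d α) (j : ℕ) :
    Fin (d.colLen j) → α :=
  fun i => T ⟨(i, j), YoungDiagram.mem_iff_lt_colLen.mpr i.2⟩

/-- The Vandermonde polynomial `∏_{j < k} (x_{i_j} - x_{i_k})` of a sequence `(i_1, …, i_m)`. -/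
noncomputable def vandermonde (K : Type*) [CommRing K] {n m : ℕ} (s : Fin m → Fin n) :
    MvPolynomial (Fin n) K :=
  ∏ j : Fin m, ∏ k ∈ Finset.Ioi j, (MvPolynomial.X (s j) - MvPolynomial.X (s k))

/-- The polynomial `spe_T(x)`: the product of the Vandermonde polynomials of the columns of `T`. -/
noncomputable def spechtPolynomial (K : Type*) [CommRing K] {n : ℕ} {d : YoungDiagram}
    (T : Filling d (Fin n)) : MvPolynomial (Fin n) K :=
  ∏ j ∈ Finset.range (d.rowLen 0), vandermonde K (T.column j)

/-- A bitableau of shape `b`: a filling of the boxes of the two diagrams of `b` with all the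
numbers of `Fin n`, each number being used exactly once. -/
abbrev Bitableau {n : ℕ} (b : Bipartition n) :=
  ({c : ℕ × ℕ // c ∈ b.fst.cells} ⊕ {c : ℕ × ℕ // c ∈ b.snd.cells}) ≃ Fin n

/-- The first component `T` of a bitableau `(T, S)`. -/
def Bitableau.left {n : ℕ} {b : Bipartition n} (U : Bitableau b) : Filling b.fst (Fin n) :=
  fun c => U (Sum.inl c)

/-- The second component `S` of a bitableau `(T, S)`. -/
def Bitableau.right {n : ℕ} {b : Bipartition n} (U : Bitableau b) : Filling b.snd (Fin n) :=
  fun c => U (Sum.inr c)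

/-- The `B_n`-Specht polynomial `spe_T(x²) * spe_S(x²) * ∏_{k ∈ S} x_k` of a bitableau `(T, S)`;
`MvPolynomial.expand 2` substitutes `x_i²` for every variable `x_i`. -/
noncomputable def bnSpechtPolynomial (K : Type*) [CommRing K] {n : ℕ} {b : Bipartition n}
    (U : Bitableau b) : MvPolynomial (Fin n) K :=
  MvPolynomial.expand 2 (spechtPolynomial K (Bitableau.left U)) *
    MvPolynomial.expand 2 (spechtPolynomial K (Bitableau.right U)) *
    ∏ c, MvPolynomial.X (Bitableau.right U c)

/-- The `B_n`-Specht ideal: generated by the Specht polynomials of all bitableaux of shape `b`. -/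
noncomputable def bnSpechtIdeal (K : Type*) [CommRing K] {n : ℕ} (b : Bipartition n) :
    Ideal (MvPolynomial (Fin n) K) :=
  Ideal.span (Set.range fun U : Bitableau b => bnSpechtPolynomial K U)

/-- The `B_n`-Specht variety: the common zeros in `K^n` of all elements of the Specht ideal. -/
noncomputable def bnSpechtVariety (K : Type*) [Field K] {n : ℕ} (b : Bipartition n) : Set (Fin n → K) :=
  MvPolynomial.zeroLocus K (bnSpechtIdeal K b)

/-! ### Orbit types -/

theorem card_cellsOfRowLens (w : List ℕ) : (YoungDiagram.cellsOfRowLens w).card = w.sum := by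
  induction w with
  | nil => simp [YoungDiagram.cellsOfRowLens]
  | cons a w ih =>
    rw [YoungDiagram.cellsOfRowLens, Finset.card_union_of_disjoint, Finset.card_map, ih]
    · simp
    · rw [Finset.disjoint_left]
      rintro ⟨i, j⟩ h1 h2
      simp at h1 h2
      omega

theorem card_ofRowLens (w : List ℕ) (hw : w.SortedGE) :
    (YoungDiagram.ofRowLens w hw).card = w.sum :=
  card_cellsOfRowLens w

theorem sum_rowLens (d : YoungDiagram) : d.rowLens.sum = d.card := by
  rw [← card_ofRowLens _ d.rowLens_sorted, YoungDiagram.ofRowLens_to_rowLens_eq_self]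

open scoped Classical in
/-- The multiset of the multiplicities with which the distinct values occur among the coordinates
of a point. -/
noncomputable def multiplicities {K : Type*} {n : ℕ} (z : Fin n → K) : Multiset ℕ :=
  (Finset.univ.image z).val.map fun a => (Finset.univ.filter fun i => z i = a).card

theorem sum_multiplicities {K : Type*} {n : ℕ} (z : Fin n → K) : (multiplicities z).sum = n := by
  classical
  have h := Finset.card_eq_sum_card_image z (Finset.univ : Finset (Fin n))
  rw [Finset.card_univ, Fintype.card_fin] at h
  refine Eq.trans ?_ h.symm
  unfold multiplicities
  rw [Finset.sum]

/-- The `S_n`-orbit type of `z`: the partition `(Λ₁, …, Λ_l)` of `n` for which `z` is a permutation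
of `(b₁, …, b₁, …, b_l, …, b_l)` with pairwise distinct `b_i`, each `b_i` occurring `Λ_i` times. -/
noncomputable def snOrbitType {K : Type*} {n : ℕ} (z : Fin n → K) : YoungDiagram :=
  YoungDiagram.ofRowLens ((multiplicities z).sort (· ≥ ·)) (Multiset.pairwise_sort _ _).sortedGE

theorem card_snOrbitType {K : Type*} {n : ℕ} (z : Fin n → K) : (snOrbitType z).card = n := by
  rw [snOrbitType, card_ofRowLens, ← Multiset.sum_coe, Multiset.sort_eq, sum_multiplicities]

/-- The first component `(t, …, t, λ_j, …, λ_m)` of the `t`-cut of `λ`, where `j` is the first index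
with `λ_j < t`: each part `λ_i` is replaced by `min λ_i t`. -/
def cutLeft (d : YoungDiagram) (t : ℕ) : YoungDiagram :=
  YoungDiagram.ofRowLens (d.rowLens.map fun r => min r t) (by
    have h := d.rowLens_sorted.pairwise
    exact (List.Pairwise.map (S := (· ≥ ·)) _ (fun a b (hab : a ≥ b) => min_le_min_right t hab) h).sortedGE)

/-- The second component `(λ_1 - t, …, λ_{j-1} - t)` of the `t`-cut of `λ`: each part `λ_i` is
replaced by the truncated difference `λ_i - t`, which is `0` for `i ≥ j`. -/
def cutRight (d : YoungDiagram) (t : ℕ) : YoungDiagram :=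
  YoungDiagram.ofRowLens (d.rowLens.map fun r => r - t) (by
    have h := d.rowLens_sorted.pairwise
    exact (List.Pairwise.map (S := (· ≥ ·)) _ (fun a b (hab : a ≥ b) => Nat.sub_le_sub_right hab t) h).sortedGE)

theorem card_cut (d : YoungDiagram) (t : ℕ) : (cutLeft d t).card + (cutRight d t).card = d.card := by
  rw [cutLeft, cutRight, card_ofRowLens, card_ofRowLens, ← sum_rowLens]
  induction d.rowLens with
  | nil => simp
  | cons a w ih =>
    simp only [List.map_cons, List.sum_cons]
    omega

/-- The `t`-cut of a partition of `n`, a bipartition of `n`. -/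
def cut {n : ℕ} (d : YoungDiagram) (hd : d.card = n) (t : ℕ) : Bipartition n where
  fst := cutLeft d t
  snd := cutRight d t
  card_add_card := (card_cut d t).trans hd

open scoped Classical in
/-- The number of zero coordinates of `z`. -/
noncomputable def zeroCount {K : Type*} [Zero K] {n : ℕ} (z : Fin n → K) : ℕ :=
  (Finset.univ.filter fun i => z i = 0).card

/-- The `B_n`-orbit type of `z`: the `t`-cut of the `S_n`-orbit type of `z² = (z_1², …, z_n²)`,
where `t` is the number of zero coordinates of `z`. -/
noncomputable def bnOrbitType {K : Type*} [CommRing K] {n : ℕ} (z : Fin n → K) : Bipartition n :=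
  cut (snOrbitType fun i => z i ^ 2) (card_snOrbitType _) (zeroCount z)

/-- The `B_n`-orbit set of the points with `B_n`-orbit type `b`. -/
def bnOrbitSet (K : Type*) [CommRing K] {n : ℕ} (b : Bipartition n) : Set (Fin n → K) :=
  {z | bnOrbitType z = b}

end BnSpecht

/-! A point `z` lies outside the variety exactly when some `spe_(T,S)` does not vanish at `z`. Over
a field this means that, with the values `w = z²` written into the boxes, every column of both
tableaux carries distinct values and no zero stands in `S`. So everything depends on how often each
value occurs in `w`, and the problem is to distribute a multiset over columns of given lengths.

Such a distribution exists if and only if the inequalities `CountBounds` hold. Necessity is a count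
(`IsAdmissible.countBounds`). Sufficiency (`CountBounds.exists_isAdmissible`) is a greedy argument
of Gale–Ryser type: the zeros go into the longest columns of the left diagram, and `exists_columns`
distributes the other values over what remains.

Finally, `CountBounds` quantifies over all finite sets of nonzero values, but only the most frequent
values matter. Sums of their multiplicities are partial sums of the orbit type, and the cut at the
number of zeros records whether zero is among them; this gives bidominance
(`bidominatedBy_bnOrbitType_iff`). As each point has exactly one orbit type, both descriptions of
the variety follow. -/

/-! ### Greedy removal and the Gale–Ryser theorem. -/

theorem exists_top_finset {ι : Type*} [DecidableEq ι] (len : ι → ℕ) (Q : Finset ι) (k : ℕ)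
    (hk : k ≤ Q.card) :
    ∃ P ⊆ Q, P.card = k ∧ ∀ i ∈ P, ∀ j ∈ Q, j ∉ P → len j ≤ len i := by
  induction k with
  | zero => exact ⟨∅, by simp, by simp, by simp⟩
  | succ k ih =>
    obtain ⟨P, hPQ, hP, htop⟩ := ih (by omega)
    have hne : (Q \ P).Nonempty := by
      rw [← Finset.card_pos, Finset.card_sdiff_of_subset hPQ]
      omega
    obtain ⟨x, hx, hmax⟩ := Finset.exists_max_image (Q \ P) len hne
    rw [Finset.mem_sdiff] at hx
    refine ⟨insert x P, Finset.insert_subset hx.1 hPQ, by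
      rw [Finset.card_insert_of_notMem hx.2, hP], ?_⟩
    intro i hi j hj hjP
    rw [Finset.mem_insert, not_or] at hjP
    rcases Finset.mem_insert.1 hi with rfl | hi
    · exact hmax j (Finset.mem_sdiff.2 ⟨hj, hjP.2⟩)
    · exact htop i hi j hj hjP.2

/-- Removing one box from each of the `t` longest columns. -/
theorem exists_removal {ι : Type*} [Fintype ι] [DecidableEq ι] (len : ι → ℕ) (t : ℕ)
    (ht : t ≤ ∑ i, min 1 (len i)) :
    ∃ P : Finset ι, P.card = t ∧ (∀ i ∈ P, 0 < len i) ∧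
      ∀ a, ∑ i, min a (len i - if i ∈ P then 1 else 0) = ∑ i, min a (len i) ∨
        ∑ i, min a (len i - if i ∈ P then 1 else 0) + t = ∑ i, min (a + 1) (len i) := by
  have hQ : ∑ i, min 1 (len i) = (Finset.univ.filter fun i => 0 < len i).card := by
    rw [Finset.card_filter]
    refine Finset.sum_congr rfl fun i _ => ?_
    split_ifs <;> omega
  obtain ⟨P, hPQ, hP, htop⟩ := exists_top_finset len _ t (hQ ▸ ht)
  have hpos : ∀ i ∈ P, 0 < len i := fun i hi => (Finset.mem_filter.1 (hPQ hi)).2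
  refine ⟨P, hP, hpos, fun a => ?_⟩
  -- If all chosen columns are longer than `a`, shortening them is invisible below height `a`.
  -- Otherwise some chosen column has length at most `a`, hence so does every unchosen one, and the
  -- sum at height `a + 1` exceeds the new sum by one per chosen column.
  by_cases h : ∀ i ∈ P, a < len i
  · left
    refine Finset.sum_congr rfl fun i _ => ?_
    split_ifs with hi
    · have := h i hi
      omega
    · rfl
  · right
    push Not at h
    obtain ⟨i₀, hi₀, hle⟩ := h
    have hPt : t = ∑ i, if i ∈ P then 1 else 0 := by simp [hP]
    rw [hPt, ← Finset.sum_add_distrib]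
    refine Finset.sum_congr rfl fun i _ => ?_
    split_ifs with hi
    · have := hpos i hi
      omega
    · have : len i ≤ a := by
        by_cases h0 : 0 < len i
        · exact (htop i₀ hi₀ i (by simpa using h0) hi).trans hle
        · omega
      omega

theorem sum_sub_indicator {ι : Type*} [Fintype ι] [DecidableEq ι] (len : ι → ℕ) (P : Finset ι)
    (hpos : ∀ i ∈ P, 0 < len i) :
    ∑ i, (len i - if i ∈ P then 1 else 0) + P.card = ∑ i, len i := by
  have hP : P.card = ∑ i, if i ∈ P then 1 else 0 := by simp
  rw [hP, ← Finset.sum_add_distrib]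
  refine Finset.sum_congr rfl fun i _ => ?_
  split_ifs with hi
  · have := hpos i hi
    omega
  · rfl

/-- A form of the Gale–Ryser theorem. -/
theorem exists_columns {ι κ : Type*} [Fintype ι] [DecidableEq ι] [DecidableEq κ] (m : κ → ℕ)
    (C : Finset κ) (len : ι → ℕ) (hsum : ∑ c ∈ C, m c = ∑ i, len i)
    (hle : ∀ A ⊆ C, ∑ c ∈ A, m c ≤ ∑ i, min A.card (len i)) :
    ∃ S : ι → Finset κ, (∀ i, S i ⊆ C) ∧ (∀ i, (S i).card = len i) ∧
      ∀ c ∈ C, (Finset.univ.filter fun i => c ∈ S i).card = m c := by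
  induction C using Finset.induction_on generalizing len with
  | empty =>
    refine ⟨fun _ => ∅, by simp, fun i => ?_, by simp⟩
    rw [Finset.sum_empty, eq_comm, Finset.sum_eq_zero_iff] at hsum
    simp [hsum i]
  | insert x C hx ih =>
    obtain ⟨P, hP, hpos, hrem⟩ := exists_removal len (m x) (by
      simpa using hle {x} (by simp))
    have hs := sum_sub_indicator len P hpos
    rw [Finset.sum_insert hx] at hsum
    obtain ⟨S, hS, hcard, hcount⟩ := ih (fun i => len i - if i ∈ P then 1 else 0)
      (by omega) (by
        intro A hA
        have hxA : x ∉ A := fun h => hx (hA h)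
        have h1 := hle A (hA.trans (Finset.subset_insert x C))
        have h2 := hle (insert x A) (Finset.insert_subset_insert x hA)
        rw [Finset.sum_insert hxA, Finset.card_insert_of_notMem hxA] at h2
        -- The two alternatives of the removal are covered by the hypothesis for `A` and for `insert
        -- x A`, respectively.
        rcases hrem A.card with h | h <;> omega)
    have hxS : ∀ i, x ∉ S i := fun i h => hx (hS i h)
    refine ⟨fun i => if i ∈ P then insert x (S i) else S i, fun i => ?_, fun i => ?_, ?_⟩
    · dsimp only
      split_ifs
      · exact Finset.insert_subset_insert x (hS i)
      · exact (hS i).trans (Finset.subset_insert x C)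
    · dsimp only
      have h := hcard i
      split_ifs at h ⊢ with hi
      · have := hpos i hi
        rw [Finset.card_insert_of_notMem (hxS i)]
        omega
      · exact h
    · intro c hc
      rcases Finset.mem_insert.1 hc with rfl | hc
      · rw [← hP]
        congr 1
        ext i
        by_cases hi : i ∈ P <;> simp [hi, hxS]
      · have hcx : c ≠ x := fun h => hx (h ▸ hc)
        rw [← hcount c hc]
        congr 1
        ext i
        by_cases hi : i ∈ P <;> simp [hi, hcx]

/-! ### Columns of Young diagrams and fillings with distinct column entries. -/

/-- Both sides count the boxes in the first `a` rows, by columns and by rows. This turns Gale–Ryser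
conditions on column lengths into dominance conditions on row lengths. -/
theorem sum_min_colLen (d : YoungDiagram) (a : ℕ) :
    ∑ j ∈ Finset.range (d.rowLen 0), min a (d.colLen j) = ∑ i ∈ Finset.range a, d.rowLen i := by
  induction a with
  | zero => simp
  | succ a ih =>
    have h : d.rowLen a = ∑ j ∈ Finset.range (d.rowLen 0), if a < d.colLen j then 1 else 0 := by
      rw [← Finset.card_filter, ← Finset.card_range (d.rowLen a)]
      congr 1
      ext j
      have h0 := d.rowLen_anti 0 a (Nat.zero_le a)
      rw [Finset.mem_filter, Finset.mem_range, Finset.mem_range,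
        ← YoungDiagram.mem_iff_lt_colLen, ← YoungDiagram.mem_iff_lt_rowLen,
        ← YoungDiagram.mem_iff_lt_rowLen]
      exact ⟨fun h => ⟨d.up_left_mem (Nat.zero_le a) le_rfl h, h⟩, And.right⟩
    rw [Finset.sum_range_succ, ← ih, h, ← Finset.sum_add_distrib]
    refine Finset.sum_congr rfl fun j _ => ?_
    split_ifs <;> omega

theorem sum_colLen (d : YoungDiagram) :
    ∑ j ∈ Finset.range (d.rowLen 0), d.colLen j = d.card := by
  rw [YoungDiagram.card, Finset.card_eq_sum_card_fiberwise (f := Prod.snd)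
    (t := Finset.range (d.rowLen 0))]
  · refine Finset.sum_congr rfl fun j _ => ?_
    rw [YoungDiagram.colLen_eq_card]
    rfl
  · rintro ⟨i, j⟩ h
    rw [Finset.mem_coe, Finset.mem_range, ← YoungDiagram.mem_iff_lt_rowLen]
    exact d.up_left_mem (Nat.zero_le i) le_rfl h

namespace BnSpecht

/-- A column of distinct entries contains each value of `A` at most once, so it contributes at most
the minimum of `A.card` and its length. -/
theorem card_filter_le_of_injective_column {K : Type*} [DecidableEq K] {d : YoungDiagram}
    (T : Filling d K) (hT : ∀ j, Function.Injective (T.column j)) (A : Finset K) :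
    (Finset.univ.filter fun x => T x ∈ A).card ≤ ∑ i ∈ Finset.range A.card, d.rowLen i := by
  rw [← sum_min_colLen, Finset.card_eq_sum_card_fiberwise (f := fun x => x.1.2)
    (t := Finset.range (d.rowLen 0))]
  · refine Finset.sum_le_sum fun j _ => le_min ?_ ?_
    · refine Finset.card_le_card_of_injOn T (fun x hx => by simp at hx; exact hx.1) ?_
      rintro ⟨⟨i, j'⟩, hx⟩ h ⟨⟨i', j''⟩, hy⟩ h' hxy
      simp only [Finset.coe_filter, Finset.mem_filter, Finset.mem_univ, true_and,
        Set.mem_ofPred_eq] at h h'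
      obtain rfl := h.2
      obtain rfl := h'.2
      have := @hT _ ⟨i, YoungDiagram.mem_iff_lt_colLen.mp hx⟩
        ⟨i', YoungDiagram.mem_iff_lt_colLen.mp hy⟩ hxy
      simp only [Fin.mk.injEq] at this
      subst this
      rfl
    · rw [← Finset.card_range (d.colLen j)]
      refine Finset.card_le_card_of_injOn (fun x => x.1.1) (fun x hx => ?_) ?_
      · simp only [Finset.coe_filter, Finset.mem_filter, Finset.mem_univ, true_and,
          Set.mem_ofPred_eq] at hx
        rw [Finset.mem_coe, Finset.mem_range, ← YoungDiagram.mem_iff_lt_colLen, ← hx.2]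
        exact x.2
      · rintro ⟨⟨i, j'⟩, hx⟩ h ⟨⟨i', j''⟩, hy⟩ h' hxy
        simp only [Finset.coe_filter, Finset.mem_filter, Finset.mem_univ, true_and,
          Set.mem_ofPred_eq] at h h' hxy
        obtain rfl := h.2
        obtain rfl := h'.2
        subst hxy
        rfl
  · rintro ⟨⟨i, j⟩, h⟩ _
    rw [Finset.mem_coe, Finset.mem_range, ← YoungDiagram.mem_iff_lt_rowLen]
    exact d.up_left_mem (Nat.zero_le i) le_rfl h

/-- Only the set of values in each column matters; any enumeration of the set fills the column. -/
theorem exists_filling_of_columns {K : Type*} [DecidableEq K] {d : YoungDiagram}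
    (S : Fin (d.rowLen 0) → Finset K) (hS : ∀ j, (S j).card = d.colLen j) :
    ∃ T : Filling d K, (∀ j, Function.Injective (T.column j)) ∧
      ∀ c, (Finset.univ.filter fun x => T x = c).card =
        (Finset.univ.filter fun j => c ∈ S j).card := by
  have hlt : ∀ {i j}, (i, j) ∈ d → j < d.rowLen 0 := fun {i j} h =>
    YoungDiagram.mem_iff_lt_rowLen.mp (d.up_left_mem (Nat.zero_le i) le_rfl h)
  let e := fun j => ((S j).equivFinOfCardEq (hS j)).symm
  let T : Filling d K := fun x =>
    (e ⟨x.1.2, hlt x.2⟩ ⟨x.1.1, YoungDiagram.mem_iff_lt_colLen.mp x.2⟩ : K)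
  have hinj : ∀ j, Function.Injective (T.column j) := by
    intro j i i' h
    exact (e ⟨j, hlt (YoungDiagram.mem_iff_lt_colLen.mpr i.2)⟩).injective (Subtype.ext h)
  refine ⟨T, hinj, fun c => ?_⟩
  refine Finset.card_bij (fun x _ => ⟨x.1.2, hlt x.2⟩) ?_ ?_ ?_
  · intro x hx
    rw [Finset.mem_filter] at hx ⊢
    refine ⟨Finset.mem_univ _, ?_⟩
    rw [← hx.2]
    exact (e _ _).2
  · rintro ⟨⟨i, j⟩, hx⟩ h ⟨⟨i', j'⟩, hy⟩ h' hxy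
    rw [Finset.mem_filter] at h h'
    simp only [Fin.mk.injEq] at hxy
    subst hxy
    have := @hinj j ⟨i, YoungDiagram.mem_iff_lt_colLen.mp hx⟩
      ⟨i', YoungDiagram.mem_iff_lt_colLen.mp hy⟩ (h.2.trans h'.2.symm)
    simp only [Fin.mk.injEq] at this
    subst this
    rfl
  · intro j hj
    rw [Finset.mem_filter] at hj
    refine ⟨⟨((e j).symm ⟨c, hj.2⟩, j),
      YoungDiagram.mem_iff_lt_colLen.mpr ((e j).symm ⟨c, hj.2⟩).2⟩, ?_, rfl⟩
    rw [Finset.mem_filter]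
    refine ⟨Finset.mem_univ _, ?_⟩
    change (e j ((e j).symm ⟨c, hj.2⟩) : K) = c
    rw [Equiv.apply_symm_apply]

/-! ### Nonvanishing of Specht polynomials at a point. -/

theorem eval_vandermonde_ne_zero {K : Type*} [Field K] {n m : ℕ} (s : Fin m → Fin n)
    (w : Fin n → K) :
    MvPolynomial.eval w (vandermonde K s) ≠ 0 ↔ Function.Injective (w ∘ s) := by
  simp only [vandermonde, map_prod, map_sub, MvPolynomial.eval_X, Finset.prod_ne_zero_iff,
    Finset.mem_univ, true_imp_iff, Finset.mem_Ioi, sub_ne_zero]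
  refine ⟨fun h i j hij => ?_, fun h i j hij he => hij.ne (h he)⟩
  rcases lt_trichotomy i j with hlt | heq | hlt
  · exact absurd hij (h i j hlt)
  · exact heq
  · exact absurd hij.symm (h j i hlt)

theorem eval_spechtPolynomial_ne_zero {K : Type*} [Field K] {n : ℕ} {d : YoungDiagram}
    (T : Filling d (Fin n)) (w : Fin n → K) :
    MvPolynomial.eval w (spechtPolynomial K T) ≠ 0 ↔
      ∀ j, Function.Injective (Filling.column (d := d) (fun x => w (T x)) j) := by
  simp only [spechtPolynomial, map_prod, Finset.prod_ne_zero_iff, eval_vandermonde_ne_zero]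
  refine ⟨fun h j => ?_, fun h j _ => h j⟩
  by_cases hj : j ∈ Finset.range (d.rowLen 0)
  · exact h j hj
  -- Columns beyond the width of the diagram are empty.
  · intro i
    refine absurd (Finset.mem_range.2 ?_) hj
    rw [← YoungDiagram.mem_iff_lt_rowLen, YoungDiagram.mem_iff_lt_colLen]
    exact (Nat.zero_le _).trans_lt i.2

theorem eval_bnSpechtPolynomial_ne_zero {K : Type*} [Field K] {n : ℕ} {b : Bipartition n}
    (U : Bitableau b) (z : Fin n → K) :
    MvPolynomial.eval z (bnSpechtPolynomial K U) ≠ 0 ↔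
      (∀ j, Function.Injective (Filling.column (d := b.fst) (fun x => z (U (Sum.inl x)) ^ 2) j)) ∧
      (∀ j, Function.Injective (Filling.column (d := b.snd) (fun x => z (U (Sum.inr x)) ^ 2) j)) ∧
      ∀ x, z (U (Sum.inr x)) ^ 2 ≠ 0 := by
  have hexp : ∀ p : MvPolynomial (Fin n) K, MvPolynomial.eval z (MvPolynomial.expand 2 p) =
      MvPolynomial.eval (fun i => z i ^ 2) p := by
    intro p
    induction p using MvPolynomial.induction_on with
    | C a => simp
    | add p q hp hq => simp [hp, hq]
    | mul_X p i hp => simp [hp]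
  rw [bnSpechtPolynomial, map_mul, map_mul, mul_ne_zero_iff, mul_ne_zero_iff, hexp, hexp,
    eval_spechtPolynomial_ne_zero, eval_spechtPolynomial_ne_zero, and_assoc, map_prod,
    Finset.prod_ne_zero_iff]
  simp [Bitableau.left, Bitableau.right]

/-! ### Value counts and admissible bitableaux. -/

open scoped Classical in
/-- The number of coordinates of `w` with value `c`. -/
noncomputable def valueCount {K : Type*} {n : ℕ} (w : Fin n → K) (c : K) : ℕ :=
  (Finset.univ.filter fun i => w i = c).card

theorem sum_valueCount {K : Type*} [DecidableEq K] {n : ℕ} (w : Fin n → K) (A : Finset K) :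
    ∑ c ∈ A, valueCount w c = (Finset.univ.filter fun i => w i ∈ A).card := by
  rw [Finset.card_eq_sum_card_fiberwise (f := w) (t := A) (fun i hi => by simpa using hi)]
  refine Finset.sum_congr rfl fun c hc => ?_
  rw [valueCount, Finset.filter_filter]
  congr 1
  ext i
  simp only [Finset.mem_filter, Finset.mem_univ, true_and]
  exact ⟨fun h => ⟨h ▸ hc, h⟩, And.right⟩

/-- The inequalities on value counts that are equivalent to bidominance of the orbit type. -/
def CountBounds {K : Type*} [Zero K] {n : ℕ} (w : Fin n → K) (b : Bipartition n) : Prop :=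
  ∀ A : Finset K, 0 ∉ A →
    ∑ c ∈ A, valueCount w c ≤
      ∑ j ∈ Finset.range A.card, b.fst.rowLen j + ∑ j ∈ Finset.range A.card, b.snd.rowLen j ∧
    ∑ c ∈ A, valueCount w c + valueCount w 0 ≤
      ∑ j ∈ Finset.range (A.card + 1), b.fst.rowLen j + ∑ j ∈ Finset.range A.card, b.snd.rowLen j

/-- A bitableau whose columns carry distinct values of `w`, with no zero in its right part. -/
def IsAdmissible {K : Type*} [Zero K] {n : ℕ} {b : Bipartition n} (w : Fin n → K)
    (U : Bitableau b) : Prop :=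
  (∀ j, Function.Injective (Filling.column (d := b.fst) (fun x => w (U (Sum.inl x))) j)) ∧
  (∀ j, Function.Injective (Filling.column (d := b.snd) (fun x => w (U (Sum.inr x))) j)) ∧
  ∀ x, w (U (Sum.inr x)) ≠ 0

/-- Zeros occur only in the left tableau, so adjoining zero to `A` allows one more row on the left
and none on the right. -/
theorem IsAdmissible.countBounds {K : Type*} [Zero K] {n : ℕ} {b : Bipartition n} {w : Fin n → K}
    {U : Bitableau b} (h : IsAdmissible w U) : CountBounds w b := by
  classical
  obtain ⟨h1, h2, h3⟩ := h
  have key : ∀ A : Finset K, ∑ c ∈ A, valueCount w c =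
      (Finset.univ.filter fun x => w (U (Sum.inl x)) ∈ A).card +
      (Finset.univ.filter fun x => w (U (Sum.inr x)) ∈ A).card := by
    intro A
    rw [sum_valueCount, Finset.card_filter, Finset.card_filter, Finset.card_filter,
      ← Equiv.sum_comp U, Fintype.sum_sum_type]
  intro A hA
  have hl := card_filter_le_of_injective_column _ h1
  have hr := card_filter_le_of_injective_column _ h2
  refine ⟨(key A).trans_le (add_le_add (hl A) (hr A)), ?_⟩
  rw [add_comm, ← Finset.sum_insert hA, key]
  refine add_le_add ?_ ((Finset.card_le_card ?_).trans (hr A))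
  · rw [← Finset.card_insert_of_notMem hA]
    exact hl _
  · intro x hx
    simp only [Finset.mem_filter, Finset.mem_univ, true_and, Finset.mem_insert] at hx ⊢
    exact hx.resolve_left (h3 x)

theorem CountBounds.exists_isAdmissible {K : Type*} [Zero K] {n : ℕ} {b : Bipartition n}
    {w : Fin n → K} (h : CountBounds w b) : ∃ U : Bitableau b, IsAdmissible w U := by
  classical
  let l₁ : Fin (b.fst.rowLen 0) → ℕ := fun j => b.fst.colLen j
  let l₂ : Fin (b.snd.rowLen 0) → ℕ := fun j => b.snd.colLen j
  have hl₁ : ∀ a, ∑ j, min a (l₁ j) = ∑ i ∈ Finset.range a, b.fst.rowLen i := fun a => by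
    rw [← sum_min_colLen, Finset.sum_range]
  have hl₂ : ∀ a, ∑ j, min a (l₂ j) = ∑ i ∈ Finset.range a, b.snd.rowLen i := fun a => by
    rw [← sum_min_colLen, Finset.sum_range]
  have hc₁ : ∑ j, l₁ j = b.fst.card := by rw [← sum_colLen, Finset.sum_range]
  have hc₂ : ∑ j, l₂ j = b.snd.card := by rw [← sum_colLen, Finset.sum_range]
  have hzero := (h ∅ (by simp)).2
  simp only [Finset.sum_empty, Finset.card_empty, Finset.range_zero, zero_add, add_zero] at hzero
  -- The bound for the empty set says that the zeros do not outnumber the left columns; one zero is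
  -- reserved in each of the longest ones.
  obtain ⟨P, hP, hpos, hrem⟩ := exists_removal l₁ (valueCount w 0) (by rwa [hl₁])
  have hs := sum_sub_indicator l₁ P hpos
  let C : Finset K := (Finset.univ.image w).erase 0
  have h0C : (0 : K) ∉ C := by simp [C]
  have htot : ∑ c ∈ C, valueCount w c + valueCount w 0 = n := by
    rw [add_comm, ← Finset.sum_insert h0C, sum_valueCount, Finset.filter_true_of_mem]
    · simp
    · intro i _
      by_cases hi : w i = 0 <;> simp [C, hi]
  have hb := b.card_add_card
  obtain ⟨S, hS, hcard, hcount⟩ := exists_columns (valueCount w) C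
    (Sum.elim (fun j => l₁ j - if j ∈ P then 1 else 0) l₂)
    (by
      simp only [Fintype.sum_sum_type, Sum.elim_inl, Sum.elim_inr]
      omega)
    (by
      intro A hA
      simp only [Fintype.sum_sum_type, Sum.elim_inl, Sum.elim_inr]
      have hh := h A fun h0 => h0C (hA h0)
      rw [← hl₁, ← hl₁, ← hl₂] at hh
      -- If the removal does not change the sum at height `A.card`, the first count bound suffices;
      -- otherwise the second one, which includes the zeros, is needed.
      rcases hrem A.card with h | h <;> omega)
  have h0S : ∀ i, (0 : K) ∉ S i := fun i hi => h0C (hS i hi)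
  obtain ⟨T₁, hT₁, hn₁⟩ := exists_filling_of_columns (d := b.fst)
    (fun j => if j ∈ P then insert 0 (S (Sum.inl j)) else S (Sum.inl j)) (by
      intro j
      have hj := hcard (Sum.inl j)
      simp only [Sum.elim_inl] at hj
      split_ifs at hj ⊢ with hi
      · have := hpos j hi
        rw [Finset.card_insert_of_notMem (h0S _), hj]
        exact Nat.sub_add_cancel this
      · exact hj)
  obtain ⟨T₂, hT₂, hn₂⟩ := exists_filling_of_columns (d := b.snd) (fun j => S (Sum.inr j))
    (fun j => hcard (Sum.inr j))
  have hfib : ∀ c, (Finset.univ.filter fun x => Sum.elim T₁ T₂ x = c).card = valueCount w c := by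
    intro c
    have hsplit : (Finset.univ.filter fun x => Sum.elim T₁ T₂ x = c).card =
        (Finset.univ.filter fun x => T₁ x = c).card +
        (Finset.univ.filter fun x => T₂ x = c).card := by
      simp only [Finset.card_filter, Fintype.sum_sum_type, Sum.elim_inl, Sum.elim_inr]
      rfl
    rw [hsplit, hn₁, hn₂]
    by_cases hc0 : c = 0
    · subst hc0
      rw [← hP, Finset.filter_false_of_mem (s := (Finset.univ : Finset (Fin (b.snd.rowLen 0))))
        fun j _ => h0S _, Finset.card_empty, add_zero]
      congr 1
      ext j
      by_cases hj : j ∈ P <;> simp [hj, h0S]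
    · have he : ∀ j, (c ∈ if j ∈ P then insert 0 (S (Sum.inl j)) else S (Sum.inl j)) ↔
          c ∈ S (Sum.inl j) := by
        intro j
        by_cases hj : j ∈ P <;> simp [hj, hc0]
      have hadd : (Finset.univ.filter fun i => c ∈ S i).card =
          (Finset.univ.filter fun j => c ∈ S (Sum.inl j)).card +
          (Finset.univ.filter fun j => c ∈ S (Sum.inr j)).card := by
        simp only [Finset.card_filter, Fintype.sum_sum_type]
      simp only [he]
      rw [← hadd]
      by_cases hcC : c ∈ C
      · exact hcount c hcC
      · rw [Finset.filter_false_of_mem fun i _ hi => hcC (hS i hi), valueCount,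
          Finset.filter_false_of_mem, Finset.card_empty, Finset.card_empty]
        intro i _ hi
        refine hcC (Finset.mem_erase.2 ⟨hc0, ?_⟩)
        simp [← hi]
  -- Each value fills as many boxes as there are coordinates carrying it, so bijections between the
  -- fibres glue to a bitableau.
  have hcardEq : ∀ c, Nonempty ({x // Sum.elim T₁ T₂ x = c} ≃ {i // w i = c}) := by
    intro c
    refine ⟨Fintype.equivOfCardEq ?_⟩
    rw [Fintype.card_subtype, Fintype.card_subtype, hfib]
    unfold valueCount
    congr!
  let U : Bitableau b := Equiv.ofFiberEquiv fun c => (hcardEq c).some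
  have hU : ∀ x, w (U x) = Sum.elim T₁ T₂ x := fun x => Equiv.ofFiberEquiv_map _ x
  refine ⟨U, ?_, ?_, ?_⟩
  · simp only [hU]
    exact hT₁
  · simp only [hU]
    exact hT₂
  · intro x hx
    rw [hU, Sum.elim_inr] at hx
    have h1 := hn₂ 0
    rw [Finset.filter_false_of_mem (s := (Finset.univ : Finset (Fin (b.snd.rowLen 0))))
        fun j _ => h0S _, Finset.card_empty, Finset.card_eq_zero] at h1
    have : x ∈ Finset.univ.filter fun x => T₂ x = 0 := by simpa using hx
    rw [h1] at this
    simp at this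

/-! ### Rows of cuts and orbit types, and the most frequent values. -/

theorem rowLen_ofRowLens_eq_getD (v : List ℕ) (hv : v.SortedGE) (i : ℕ) :
    (YoungDiagram.ofRowLens v hv).rowLen i = v.getD i 0 := by
  by_cases hi : i < v.length
  · rw [List.getD_eq_getElem _ _ hi]
    exact YoungDiagram.rowLen_ofRowLens ⟨i, hi⟩
  · rw [List.getD_eq_default _ _ (not_lt.1 hi)]
    by_contra h
    have hm := YoungDiagram.mem_iff_lt_rowLen.mpr (Nat.pos_of_ne_zero h)
    rw [YoungDiagram.mem_ofRowLens] at hm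
    exact hi hm.1

theorem rowLen_eq_getD_rowLens (d : YoungDiagram) (i : ℕ) : d.rowLen i = d.rowLens.getD i 0 := by
  conv_lhs => rw [← d.ofRowLens_to_rowLens_eq_self]
  exact rowLen_ofRowLens_eq_getD _ _ i

theorem rowLen_cutLeft (d : YoungDiagram) (t i : ℕ) :
    (cutLeft d t).rowLen i = min (d.rowLen i) t := by
  rw [cutLeft, rowLen_ofRowLens_eq_getD, rowLen_eq_getD_rowLens d]
  -- The default `0` is fixed by the truncation, so rows past the end agree as well.
  simpa using List.getD_map (l := d.rowLens) (d := 0) (n := i) (f := fun r => min r t)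

theorem rowLen_cutRight (d : YoungDiagram) (t i : ℕ) :
    (cutRight d t).rowLen i = d.rowLen i - t := by
  rw [cutRight, rowLen_ofRowLens_eq_getD, rowLen_eq_getD_rowLens d]
  simpa using List.getD_map (l := d.rowLens) (d := 0) (n := i) (f := fun r => r - t)

theorem sum_take_eq_sum_getD (v : List ℕ) (k : ℕ) :
    (v.take k).sum = ∑ j ∈ Finset.range k, v.getD j 0 := by
  induction v generalizing k with
  | nil => simp
  | cons a v ih =>
    cases k with
    | zero => simp
    | succ k => simp [Finset.sum_range_succ', ih, add_comm]

/-- The values of `w`, listed by decreasing multiplicity. -/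
theorem exists_list_values {K : Type*} {n : ℕ} (w : Fin n → K) :
    ∃ L : List K, L.Nodup ∧ (∀ c, c ∉ L → valueCount w c = 0) ∧
      L.Pairwise (fun a b => valueCount w b ≤ valueCount w a) ∧
      ∀ j, (snOrbitType w).rowLen j = (L.map (valueCount w)).getD j 0 := by
  classical
  let r : K → K → Prop := fun a b => valueCount w b ≤ valueCount w a
  have : Std.Total r := ⟨fun a b => le_total (valueCount w b) (valueCount w a)⟩
  have : IsTrans K r := ⟨fun a b c hab hbc => le_trans hbc hab⟩
  have hperm := List.perm_insertionSort r (Finset.univ.image w).toList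
  have hsort := List.pairwise_insertionSort r (Finset.univ.image w).toList
  set L := (Finset.univ.image w).toList.insertionSort r
  refine ⟨L, hperm.nodup_iff.2 (Finset.nodup_toList _), fun c hc => ?_, hsort, fun j => ?_⟩
  · rw [hperm.mem_iff, Finset.mem_toList, Finset.mem_image] at hc
    rw [valueCount, Finset.card_eq_zero, Finset.filter_eq_empty_iff]
    exact fun i _ hi => hc ⟨i, Finset.mem_univ _, hi⟩
  · rw [snOrbitType, rowLen_ofRowLens_eq_getD]
    congr 1
    refine List.Perm.eq_of_pairwise (le := (· ≥ ·)) (fun a b _ _ hab hba => le_antisymm hba hab)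
      (Multiset.pairwise_sort _ _) (List.pairwise_map.2 hsort) ?_
    rw [← Multiset.coe_eq_coe, Multiset.sort_eq, ← Multiset.map_coe,
      Multiset.coe_eq_coe.2 hperm, Finset.coe_toList, multiplicities]
    refine Multiset.map_congr ?_ fun c _ => ?_
    · congr!
    · unfold valueCount
      congr!

theorem exists_top_values {K : Type*} {n : ℕ} (w : Fin n → K) :
    ∃ B : ℕ → Finset K, Monotone B ∧ ∀ k, (B k).card ≤ k ∧
      ((B k).card = k ∨ (snOrbitType w).rowLen k = 0) ∧
      ∑ c ∈ B k, valueCount w c = ∑ j ∈ Finset.range k, (snOrbitType w).rowLen j ∧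
      (∀ c ∈ B k, (snOrbitType w).rowLen k ≤ valueCount w c) ∧
      ∀ c ∉ B k, valueCount w c ≤ (snOrbitType w).rowLen k := by
  classical
  obtain ⟨L, hnd, hL, hsort, hrow⟩ := exists_list_values w
  have hrow_lt : ∀ {k} (hk : k < L.length), (snOrbitType w).rowLen k = valueCount w L[k] := by
    intro k hk
    rw [hrow, List.getD_eq_getElem _ _ (by simpa using hk), List.getElem_map]
  have hrow_ge : ∀ {k}, L.length ≤ k → (snOrbitType w).rowLen k = 0 := by
    intro k hk
    rw [hrow, List.getD_eq_default _ _ (by simpa using hk)]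
  have hanti := (snOrbitType w).rowLen_anti
  -- Once `k` exceeds the number of distinct values, `B k` has fewer than `k` elements, but then row
  -- `k` is zero.
  refine ⟨fun k => (L.take k).toFinset, fun a b hab c hc => ?_, fun k => ⟨?_, ?_, ?_, ?_, ?_⟩⟩
  · rw [List.mem_toFinset] at hc ⊢
    exact (List.take_subset_take_left L hab) hc
  · exact (List.toFinset_card_le _).trans (List.length_take_le _ _)
  · rw [List.toFinset_card_of_nodup (hnd.sublist (List.take_sublist _ _)), List.length_take]
    rcases le_total k L.length with h | h
    · exact Or.inl (min_eq_left h)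
    · exact Or.inr (hrow_ge h)
  · rw [List.sum_toFinset _ (hnd.sublist (List.take_sublist _ _)), List.map_take,
      sum_take_eq_sum_getD]
    exact Finset.sum_congr rfl fun j _ => (hrow j).symm
  · intro c hc
    rw [List.mem_toFinset, List.mem_take_iff_getElem] at hc
    obtain ⟨i, hi, rfl⟩ := hc
    rw [lt_min_iff] at hi
    rw [← hrow_lt hi.2]
    exact hanti _ _ hi.1.le
  · intro c hc
    by_cases hcL : c ∈ L
    · obtain ⟨i, hi, rfl⟩ := List.getElem_of_mem hcL
      have hki : k ≤ i := by
        by_contra hlt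
        refine hc ?_
        rw [List.mem_toFinset, List.mem_take_iff_getElem]
        exact ⟨i, lt_min (not_le.1 hlt) hi, rfl⟩
      rw [← hrow_lt hi]
      exact hanti _ _ hki
    · rw [hL c hcL]
      exact Nat.zero_le _

/-- Exchange argument: outside the common part, values of `A` occur at most `r` times and values of
`B k` at least `r` times, where `r` is row `k` of the orbit type. -/
theorem sum_valueCount_le {K : Type*} {n : ℕ} (w : Fin n → K) (A : Finset K) :
    ∑ c ∈ A, valueCount w c ≤ ∑ j ∈ Finset.range A.card, (snOrbitType w).rowLen j := by
  classical
  obtain ⟨B, -, hB⟩ := exists_top_values w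
  obtain ⟨-, hcard, hsum, hge, hle⟩ := hB A.card
  set k := A.card
  set r := (snOrbitType w).rowLen k
  rw [← hsum, ← Finset.sum_inter_add_sum_sdiff A (B k), ← Finset.sum_inter_add_sum_sdiff (B k) A,
    Finset.inter_comm (B k) A]
  refine Nat.add_le_add_left ?_ _
  calc ∑ c ∈ A \ B k, valueCount w c ≤ (A \ B k).card • r :=
        Finset.sum_le_card_nsmul _ _ _ fun c hc => hle c (Finset.mem_sdiff.1 hc).2
    _ ≤ (B k \ A).card • r := by
        rcases hcard with h | h
        · rw [Finset.card_sdiff_comm h]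
        · simp [h]
    _ ≤ _ := Finset.card_nsmul_le_sum _ _ _ fun c hc => hge c (Finset.mem_sdiff.1 hc).1

/-! ### Bidominance in terms of value counts, and the variety. -/

theorem zeroCount_eq_valueCount {K : Type*} [Field K] {n : ℕ} (z : Fin n → K) :
    zeroCount z = valueCount (fun i => z i ^ 2) 0 := by
  unfold zeroCount valueCount
  congr 1
  ext i
  simp

theorem bidominatedBy_bnOrbitType_iff {K : Type*} [Field K] {n : ℕ} (z : Fin n → K)
    (b : Bipartition n) :
    BidominatedBy (bnOrbitType z) b ↔ CountBounds (fun i => z i ^ 2) b := by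
  classical
  set w : Fin n → K := fun i => z i ^ 2 with hw
  have hfst : ∀ j, (bnOrbitType z).fst.rowLen j =
      min ((snOrbitType w).rowLen j) (valueCount w 0) := fun j => by
    rw [hw, ← zeroCount_eq_valueCount]
    exact rowLen_cutLeft _ _ _
  -- The two parts of a cut add up to the original row, so the cut enters only through the last term
  -- of the second inequality.
  have hadd : ∀ j, (bnOrbitType z).fst.rowLen j + (bnOrbitType z).snd.rowLen j =
      (snOrbitType w).rowLen j := fun j => by
    rw [hfst, hw, ← zeroCount_eq_valueCount]
    have : (bnOrbitType z).snd.rowLen j = (snOrbitType w).rowLen j - zeroCount z :=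
      rowLen_cutRight _ _ _
    rw [this, ← hw]
    omega
  unfold BidominatedBy
  simp only [hadd]
  simp only [hfst, Finset.sum_add_distrib]
  have hmono : ∀ d : YoungDiagram, ∀ a a' : ℕ, a ≤ a' →
      ∑ j ∈ Finset.range a, d.rowLen j ≤ ∑ j ∈ Finset.range a', d.rowLen j := fun d a a' h =>
    Finset.sum_le_sum_of_subset (Finset.range_mono h)
  constructor
  · intro h A hA
    -- Bounding the count of `A` alone and that of `A` with zero yields the two entries of the
    -- minimum in row `A.card` of the cut.
    have hA1 := sum_valueCount_le w A
    have hA2 := sum_valueCount_le w (insert 0 A)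
    rw [Finset.sum_insert hA, Finset.card_insert_of_notMem hA, Finset.sum_range_succ] at hA2
    constructor
    · refine hA1.trans ?_
      rcases Nat.eq_zero_or_pos A.card with h0 | h0
      · simp [h0]
      · have := (h (A.card - 1)).1
        rwa [Nat.sub_add_cancel h0] at this
    · have := (h A.card).2
      rw [Finset.sum_range_succ]
      omega
  · intro h k
    obtain ⟨B, hB, hBk⟩ := exists_top_values w
    -- When zero is among the top `k + 1` values, at most `k` nonzero ones remain, and the second
    -- count bound for these is stronger than what bidominance asks.
    have key : ∀ k, 0 ∈ B (k + 1) → ∑ j ∈ Finset.range (k + 1), (snOrbitType w).rowLen j ≤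
        ∑ j ∈ Finset.range (k + 1), b.fst.rowLen j + ∑ j ∈ Finset.range k, b.snd.rowLen j := by
      intro k h0
      obtain ⟨hcard, -, hsum, -⟩ := hBk (k + 1)
      have h2 := (h ((B (k + 1)).erase 0) (by simp)).2
      rw [Finset.sum_erase_add _ _ h0, Finset.card_erase_of_mem h0, hsum] at h2
      exact h2.trans (add_le_add (hmono _ _ _ (by omega)) (hmono _ _ _ (by omega)))
    constructor
    · by_cases h0 : 0 ∈ B (k + 1)
      · exact (key k h0).trans (Nat.add_le_add_left (hmono _ _ _ (Nat.le_succ k)) _)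
      · obtain ⟨hcard, -, hsum, -⟩ := hBk (k + 1)
        rw [← hsum]
        exact (h _ h0).1.trans (add_le_add (hmono _ _ _ hcard) (hmono _ _ _ hcard))
    · by_cases h0 : 0 ∈ B k
      · have := key k (hB (Nat.le_succ k) h0)
        rw [Finset.sum_range_succ, Finset.sum_range_succ] at this
        omega
      · obtain ⟨hcard, -, hsum, -⟩ := hBk k
        have h2 := (h _ h0).2
        rw [hsum] at h2
        have h3 := hmono b.fst _ _ (Nat.succ_le_succ hcard)
        have h4 := hmono b.snd _ _ hcard
        simp only [Nat.succ_eq_add_one] at h3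
        rw [Finset.sum_range_succ _ k] at h3
        omega

theorem mem_bnSpechtVariety_iff {K : Type*} [Field K] {n : ℕ} (b : Bipartition n)
    (z : Fin n → K) :
    z ∈ bnSpechtVariety K b ↔ ¬ BidominatedBy (bnOrbitType z) b := by
  have hV : z ∈ bnSpechtVariety K b ↔
      ∀ U : Bitableau b, MvPolynomial.eval z (bnSpechtPolynomial K U) = 0 := by
    rw [bnSpechtVariety, bnSpechtIdeal, MvPolynomial.zeroLocus_span]
    simp [MvPolynomial.aeval_eq_eval]
  rw [hV, bidominatedBy_bnOrbitType_iff, ← not_iff_not, not_not, not_forall]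
  constructor
  · rintro ⟨U, hU⟩
    exact IsAdmissible.countBounds ((eval_bnSpechtPolynomial_ne_zero U z).1 hU)
  · intro h
    obtain ⟨U, hU⟩ := h.exists_isAdmissible
    exact ⟨U, (eval_bnSpechtPolynomial_ne_zero U z).2 hU⟩

end BnSpecht

theorem mainTheorem2 (K : Type*) [Field K] [CharZero K] (n : ℕ) (b : BnSpecht.Bipartition n) :
    BnSpecht.bnSpechtVariety K b =
        (⋃ (c : BnSpecht.Bipartition n) (_ : BnSpecht.BidominatedBy c b),
          BnSpecht.bnOrbitSet K c)ᶜ ∧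
      BnSpecht.bnSpechtVariety K b =
        ⋃ (c : BnSpecht.Bipartition n) (_ : ¬ BnSpecht.BidominatedBy c b),
          BnSpecht.bnOrbitSet K c := by
  constructor
  · ext z
    rw [BnSpecht.mem_bnSpechtVariety_iff]
    simp only [BnSpecht.bnOrbitSet, Set.mem_compl_iff, Set.mem_iUnion, Set.mem_ofPred_eq]
    exact not_congr ⟨fun h => ⟨_, h, rfl⟩, by rintro ⟨c, h, rfl⟩; exact h⟩
  · ext z
    rw [BnSpecht.mem_bnSpechtVariety_iff]
    simp [BnSpecht.bnOrbitSet]
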